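/- All graphs are finite, connected, undirected and simple, and have at least one vertex; $d$ denotes the shortest-path distance of the graph $G=(V,E)$. A graph $G$ is a Helly graph if every family of pairwise intersecting disks $D(v,r)=\{u\in V: d(v,u)\le r\}$ ($v\in V$, $r\in\mathbb{N}$) has a common vertex. The hyperbolicity $hb(G)$ is the smallest real number $\delta$ such that for any four (not necessarily distinct) vertices $u,v,w,x$ of $G$ the two larger of the three sums $d(u,v)+d(w,x)$, $d(u,w)+d(v,x)$, $d(u,x)+d(v,w)$ differ by at most $2\delta$. The power $G^\ell$ is the graph on $V$ in which two distinct vertices are adjacent if and only if their distance in $G$ is at most $\ell$. Four distinct vertices form a $C_4$ (respectively, a diamond) in a graph if the subgraph they induce is a cycle of length four (respectively, a cycle of length four with exactly one of its two diagonals added). For integers $a,b$, $[a,b]$ is the set of integers $\ell$ with $a\le\ell\le b$ (empty if $a>b$). Theorem. Let $G$ be a Helly graph and let $k$ be a non-negative integer. Then: (1) $hb(G)\le k$ if and only if there are no four vertices of $G$ that form a $C_4$ in $G^\ell$ for all $\ell\in[k+1,2k]$ and also form a diamond in $G^{2k+1}$. (2) $hb(G)\le k+\tfrac12$ if and only if there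 are no four vertices of $G$ that form a $C_4$ in $G^\ell$ for all $\ell\in[k+1,2k+1]$, and there are no four vertices of $G$ that form a $C_4$ in $G^\ell$ for all $\ell\in[k+2,2k+2]$. -/

import Mathlib

namespace HellyHyp

variable {V : Type*}

/-- The disk `D(v, r)`: all vertices at distance at most `r` from `v`
(all graphs under consideration are connected). -/
def disk (G : SimpleGraph V) (v : V) (r : ℕ) : Set V :=
  {u | G.dist v u ≤ r}

/-- A family `F` of sets has the Helly property if every pairwise intersecting subfamily
has a common point. -/
def HellyProperty (F : Set (Set V)) : Prop :=
  ∀ F' ⊆ F, (∀ A ∈ F', ∀ B ∈ F', (A ∩ B).Nonempty) → (⋂₀ F').Nonempty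

/-- A graph is Helly if the family of all its disks has the Helly property. -/
def IsHelly (G : SimpleGraph V) : Prop :=
  HellyProperty {D : Set V | ∃ (v : V) (r : ℕ), D = disk G v r}

/-- The four-point condition: for any four vertices, the two larger of the three distance sums
differ by at most `2 * δ`. The three sums of a quadruple are permuted when its vertices are,
so it is enough to speak about the labellings `u, v, w, x` for which
`d(u,v) + d(w,x) ≥ d(u,w) + d(v,x) ≥ d(u,x) + d(v,w)`. -/
def IsHyperbolic (G : SimpleGraph V) (δ : ℝ) : Prop :=
  ∀ u v w x : V,
    G.dist u w + G.dist v x ≤ G.dist u v + G.dist w x →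
    G.dist u x + G.dist v w ≤ G.dist u w + G.dist v x →
    ((G.dist u v : ℝ) + G.dist w x) - (G.dist u w + G.dist v x) ≤ 2 * δ

/-- The hyperbolicity of `G`: the smallest `δ` for which `G` is `δ`-hyperbolic
(for finite nonempty graphs the infimum is attained, see `isLeast_hb`). -/
noncomputable def hb (G : SimpleGraph V) : ℝ :=
  sInf {δ : ℝ | IsHyperbolic G δ}

theorem isLeast_hb [Finite V] [Nonempty V] (G : SimpleGraph V) :
    IsLeast {δ : ℝ | IsHyperbolic G δ} (hb G) := by
  have hbdd : BddBelow {δ : ℝ | IsHyperbolic G δ} := by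
    refine ⟨0, fun δ hδ => ?_⟩
    obtain ⟨v⟩ := ‹Nonempty V›
    have h := hδ v v v v le_rfl le_rfl
    simp only [SimpleGraph.dist_self] at h
    norm_num at h
    exact h
  have hne : {δ : ℝ | IsHyperbolic G δ}.Nonempty := by
    obtain ⟨M, hM⟩ := (Set.finite_range (fun p : V × V => (G.dist p.1 p.2 : ℝ))).bddAbove
    have hd : ∀ a b : V, (G.dist a b : ℝ) ≤ M := fun a b => hM ⟨(a, b), rfl⟩
    refine ⟨M, fun u v w x _ _ => ?_⟩
    have h1 := hd u v
    have h2 := hd w x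
    have h3 : (0 : ℝ) ≤ G.dist u w := Nat.cast_nonneg _
    have h4 : (0 : ℝ) ≤ G.dist v x := Nat.cast_nonneg _
    linarith
  refine ⟨fun u v w x h1 h2 => ?_, fun δ hδ => csInf_le hbdd hδ⟩
  have h : (((G.dist u v : ℝ) + G.dist w x) - (G.dist u w + G.dist v x)) / 2 ≤ hb G :=
    le_csInf hne fun δ hδ => by
      have h3 := hδ u v w x h1 h2
      linarith
  linarith

/-- The `k`-th power of `G`: distinct vertices are adjacent when at distance at most `k` in `G`
(for connected `G`). -/
def power (G : SimpleGraph V) (k : ℕ) : SimpleGraph V where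
  Adj u v := u ≠ v ∧ G.dist u v ≤ k
  symm := ⟨fun _ _ h => ⟨h.1.symm, by rw [SimpleGraph.dist_comm]; exact h.2⟩⟩
  loopless := ⟨fun _ h => h.1 rfl⟩

/-- The diamond: the cycle `C₄` on `0, 1, 2, 3` together with the diagonal `0 2`. -/
def diamond : SimpleGraph (Fin 4) :=
  SimpleGraph.cycleGraph 4 ⊔ SimpleGraph.edge 0 2

/-- The vertices of `S` form a `C₄` in `H`: the subgraph induced by `S` is a four-cycle. -/
def FormsC4 (H : SimpleGraph V) (S : Set V) : Prop :=
  Nonempty (H.induce S ≃g SimpleGraph.cycleGraph 4)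

/-- The vertices of `S` form a diamond in `H`: the subgraph induced by `S` is a diamond. -/
def FormsDiamond (H : SimpleGraph V) (S : Set V) : Prop :=
  Nonempty (H.induce S ≃g diamond)

end HellyHyp

/-!
Let `u, v` and `w, x` be the diagonals of a quadruple of vertices and the other four pairs its
sides. A set is a four-cycle in all the powers `G^a, ..., G^b` exactly when it is a quadruple whose
sides have length at most `a` and whose diagonals have length more than `b`
(`FormsC4.exists_corners`, `exists_formsC4_of_dist`), and the diamond condition pins one diagonal to
length `2k + 1`. On the other hand `hb G ≤ m / 2` fails exactly when some quadruple is separated by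
`m + 1`: its sum of diagonals exceeds both sums of opposite sides by at least `m + 1`
(`hb_le_half_iff`). So forbidden quadruples are clearly separated, and the theorem asks for the
converse: a separated quadruple can be turned into one with short sides and long diagonals.

The tight span of four points is a rectangle with a leg attached at each corner, and the square with
the shorter side of that rectangle has the same separation. In a Helly graph this reduction can be
carried out inside the graph, one step at a time: by the Helly property a vertex can be moved to a
neighbour within prescribed distances of two others whenever the triangle inequalities permit
(`IsHelly.exists_step`). Instead of tracking the moves, take a separated quadruple that minimizes
`weight`. Each possible move that keeps the separation contradicts minimality, and what remains is
rigid: all sides have the same length `p` and the diagonals have length `2p - 1` or `2p`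
(`IsMinSeparated.exists_side`). Shrinking the square itself costs at most two units of separation,
so the separation of a minimal quadruple is nearly the required one (`IsMinSeparated.diag_sum_le`,
`IsMinSeparated.diag_sum_le_of_odd`). This leaves few values for `p` and the diagonals, and they are
the forbidden quadruples (`Separated.exists_odd_square`, `Separated.exists_even_square`).
-/

namespace HellyHyp

variable {V : Type*}

/-! ### Metric consequences of the Helly property -/

theorem exists_dist_le_of_dist_le_add {G : SimpleGraph V} (hconn : G.Connected) {u v : V} {r s : ℕ}
    (h : G.dist u v ≤ r + s) : ∃ z, G.dist u z ≤ r ∧ G.dist v z ≤ s := by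
  obtain ⟨p, hp⟩ := hconn.exists_walk_length_eq_dist u v
  refine ⟨p.getVert r, ?_, ?_⟩
  · have h1 := SimpleGraph.dist_le (p.take r)
    rw [SimpleGraph.Walk.take_length] at h1
    omega
  · have h1 := SimpleGraph.dist_le (p.drop r)
    rw [SimpleGraph.Walk.drop_length] at h1
    rw [SimpleGraph.dist_comm]
    omega

/-- In a connected Helly graph, disks whose radii pairwise sum to at least the distance of their
centres have a common vertex. -/
theorem IsHelly.exists_forall_dist_le {G : SimpleGraph V} (hHelly : IsHelly G)
    (hconn : G.Connected) {ι : Type*} (c : ι → V) (r : ι → ℕ)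
    (h : ∀ i j, G.dist (c i) (c j) ≤ r i + r j) : ∃ z, ∀ i, G.dist (c i) z ≤ r i := by
  obtain ⟨z, hz⟩ := hHelly (Set.range fun i => disk G (c i) (r i))
    (by rintro _ ⟨i, rfl⟩; exact ⟨c i, r i, rfl⟩)
    (by
      rintro _ ⟨i, rfl⟩ _ ⟨j, rfl⟩
      obtain ⟨z, h1, h2⟩ := exists_dist_le_of_dist_le_add hconn (h i j)
      exact ⟨z, h1, h2⟩)
  exact ⟨z, fun i => hz _ ⟨i, rfl⟩⟩

theorem IsHelly.exists_dist_le₄ {G : SimpleGraph V} (hHelly : IsHelly G) (hconn : G.Connected)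
    {a b c d : V} {p q r s : ℕ} (hab : G.dist a b ≤ p + q) (hac : G.dist a c ≤ p + r)
    (had : G.dist a d ≤ p + s) (hbc : G.dist b c ≤ q + r) (hbd : G.dist b d ≤ q + s)
    (hcd : G.dist c d ≤ r + s) :
    ∃ z, G.dist a z ≤ p ∧ G.dist b z ≤ q ∧ G.dist c z ≤ r ∧ G.dist d z ≤ s := by
  obtain ⟨z, hz⟩ := hHelly.exists_forall_dist_le hconn ![a, b, c, d] ![p, q, r, s] (by
    have := G.dist_comm (u := a) (v := b)
    have := G.dist_comm (u := a) (v := c)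
    have := G.dist_comm (u := a) (v := d)
    have := G.dist_comm (u := b) (v := c)
    have := G.dist_comm (u := b) (v := d)
    have := G.dist_comm (u := c) (v := d)
    intro i j
    fin_cases i <;> fin_cases j <;> simp <;> omega)
  exact ⟨z, hz 0, hz 1, hz 2, hz 3⟩

/-- A vertex `u` can be replaced by itself or a neighbour so as to lie within prescribed distances of
`w` and `x`; its distance to any other vertex changes by at most one. -/
theorem IsHelly.exists_step {G : SimpleGraph V} (hHelly : IsHelly G) (hconn : G.Connected)
    {u w x : V} {r s : ℕ} (hw : G.dist u w ≤ r + 1) (hx : G.dist u x ≤ s + 1)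
    (hwx : G.dist w x ≤ r + s) :
    ∃ u', G.dist u' w ≤ r ∧ G.dist u' x ≤ s ∧ 
      ∀ y, G.dist u y ≤ G.dist u' y + 1 ∧ G.dist u' y ≤ G.dist u y + 1 := by
  obtain ⟨z, h1, h2, h3, -⟩ := hHelly.exists_dist_le₄ hconn (a := u) (b := w) (c := x) (d := u)
    (p := 1) (q := r) (r := s) (s := 1) (by omega) (by omega) (by simp) hwx
    (by rw [SimpleGraph.dist_comm]; omega) (by rw [SimpleGraph.dist_comm]; omega)
  rw [SimpleGraph.dist_comm] at h2 h3
  refine ⟨z, h2, h3, fun y => ?_⟩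
  have := hconn.dist_triangle (u := u) (v := z) (w := y)
  have := hconn.dist_triangle (u := z) (v := u) (w := y)
  have := G.dist_comm (u := u) (v := z)
  omega

/-! ### Separated quadruples of least weight -/

/-- The distance sum `d(u,v) + d(w,x)` exceeds each of the other two distance sums of the quadruple
by at least `N`. The pairs `u, v` and `w, x` are the diagonals of the quadruple and the other four
pairs are its sides. -/
structure Separated (G : SimpleGraph V) (N : ℕ) (u v w x : V) : Prop where
  left : G.dist u w + G.dist v x + N ≤ G.dist u v + G.dist w x
  right : G.dist u x + G.dist v w + N ≤ G.dist u v + G.dist w x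

/-- The quantity decreased by the Helly moves: the sum of the four sides plus the larger of the two
sums of opposite sides. -/
noncomputable def weight (G : SimpleGraph V) (u v w x : V) : ℕ :=
  (G.dist u w + G.dist v x) + (G.dist u x + G.dist v w) +
    max (G.dist u w + G.dist v x) (G.dist u x + G.dist v w)

/-- A separated quadruple of least weight. -/
structure IsMinSeparated (G : SimpleGraph V) (N : ℕ) (u v w x : V) : Prop where
  separated : Separated G N u v w x
  weight_le : ∀ u' v' w' x', Separated G N u' v' w' x' → weight G u v w x ≤ weight G u' v' w' x'

theorem Separated.exists_isMinSeparated {G : SimpleGraph V} {N : ℕ} {u v w x : V}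
    (h : Separated G N u v w x) : ∃ u v w x, IsMinSeparated G N u v w x := by
  induction hM : weight G u v w x using Nat.strong_induction_on generalizing u v w x with
  | _ M ih =>
    by_contra hcon
    refine hcon ⟨u, v, w, x, h, fun u' v' w' x' h' => ?_⟩
    by_contra hlt
    exact hcon (ih _ (by omega) h' rfl)

section IsMinSeparated

variable {G : SimpleGraph V} {N : ℕ} {u v w x : V}

theorem Separated.swap (h : Separated G N u v w x) : Separated G N v u w x := by
  obtain ⟨h1, h2⟩ := h
  have := G.dist_comm (u := u) (v := v)
  constructor <;> omega

theorem IsMinSeparated.swap (h : IsMinSeparated G N u v w x) : IsMinSeparated G N v u w x := by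
  refine ⟨h.separated.swap, fun u' v' w' x' h' => le_trans (le_of_eq ?_) (h.weight_le _ _ _ _ h')⟩
  unfold weight
  omega

theorem IsMinSeparated.transpose (h : IsMinSeparated G N u v w x) :
    IsMinSeparated G N w x u v := by
  obtain ⟨⟨h1, h2⟩, h3⟩ := h
  have := G.dist_comm (u := u) (v := w)
  have := G.dist_comm (u := u) (v := x)
  have := G.dist_comm (u := v) (v := w)
  have := G.dist_comm (u := v) (v := x)
  refine ⟨⟨by omega, by omega⟩, fun u' v' w' x' h' => le_trans (le_of_eq ?_) (h3 _ _ _ _ h')⟩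
  unfold weight
  omega

/-- Exchanging the vertices within both diagonals keeps the two sums of opposite sides. -/
theorem IsMinSeparated.swap_both (h : IsMinSeparated G N u v w x) :
    IsMinSeparated G N v u x w :=
  h.swap.transpose.swap.transpose

/-- Otherwise `u` could be moved closer to both `w` and `x`. -/
theorem IsMinSeparated.dist_add_dist_le (h : IsMinSeparated G N u v w x) (hHelly : IsHelly G)
    (hconn : G.Connected) : G.dist u w + G.dist u x ≤ G.dist w x + 1 := by
  by_contra hlt
  have := hconn.dist_triangle (u := u) (v := w) (w := x)
  have := hconn.dist_triangle (u := u) (v := x) (w := w)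
  have := G.dist_comm (u := w) (v := x)
  obtain ⟨u', h1, h2, h3⟩ := hHelly.exists_step hconn (u := u) (w := w) (x := x)
    (r := G.dist u w - 1) (s := G.dist u x - 1) (by omega) (by omega) (by omega)
  have h4 := h3 v
  obtain ⟨h5, h6⟩ := h.separated
  have h7 := h.weight_le u' v w x ⟨by omega, by omega⟩
  unfold weight at h7
  omega

/-- Otherwise `u` could be moved closer to `w`, shortening the larger of the two sums of opposite
sides, without getting farther from `x`. -/
theorem IsMinSeparated.dist_add_dist_le_of_lt (h : IsMinSeparated G N u v w x) (hHelly : IsHelly G)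
    (hconn : G.Connected) (hlt : G.dist u x + G.dist v w < G.dist u w + G.dist v x) :
    G.dist u w + G.dist u x ≤ G.dist w x := by
  by_contra hlt'
  have := hconn.dist_triangle (u := u) (v := w) (w := x)
  have := hconn.dist_triangle (u := u) (v := x) (w := w)
  have := G.dist_comm (u := w) (v := x)
  obtain ⟨u', h1, h2, h3⟩ := hHelly.exists_step hconn (u := u) (w := w) (x := x)
    (r := G.dist u w - 1) (s := G.dist u x) (by omega) (by omega) (by omega)
  have h4 := h3 v
  obtain ⟨h5, h6⟩ := h.separated
  have h7 := h.weight_le u' v w x ⟨by omega, by omega⟩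
  unfold weight at h7
  omega

/-- If the sum were larger, the quadruple would be an exact rectangle, which is shortened by moving
`u` along a long side towards `w`. -/
theorem IsMinSeparated.side_sum_le (h : IsMinSeparated G N u v w x) (hHelly : IsHelly G)
    (hconn : G.Connected) : G.dist u w + G.dist v x ≤ G.dist u x + G.dist v w := by
  by_contra! hlt
  have := G.dist_comm (u := u) (v := v)
  have := G.dist_comm (u := u) (v := w)
  have := G.dist_comm (u := u) (v := x)
  have := G.dist_comm (u := v) (v := w)
  have := G.dist_comm (u := v) (v := x)
  have := G.dist_comm (u := w) (v := x)
  have hu := h.dist_add_dist_le_of_lt hHelly hconn hlt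
  have hv := h.swap_both.dist_add_dist_le_of_lt hHelly hconn (by omega)
  have hw := h.transpose.dist_add_dist_le_of_lt hHelly hconn (by omega)
  have hx := h.transpose.swap_both.dist_add_dist_le_of_lt hHelly hconn (by omega)
  have := hconn.dist_triangle (u := w) (v := u) (w := x)
  have := hconn.dist_triangle (u := w) (v := v) (w := x)
  have := hconn.dist_triangle (u := u) (v := w) (w := v)
  have := hconn.dist_triangle (u := u) (v := x) (w := v)
  obtain ⟨u', h1, h2, h3⟩ := hHelly.exists_step hconn (u := u) (w := w) (x := x)
    (r := G.dist u w - 1) (s := G.dist u x + 1) (by omega) (by omega) (by omega)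
  have h4 := h3 v
  obtain ⟨h5, h6⟩ := h.separated
  have h7 := h.weight_le u' v w x ⟨by omega, by omega⟩
  unfold weight at h7
  omega

/-- A separated quadruple of least weight is a square: its sides are equal and its diagonals are
as long as the sides permit, up to one. -/
theorem IsMinSeparated.exists_side (h : IsMinSeparated G N u v w x) (hHelly : IsHelly G)
    (hconn : G.Connected) :
    ∃ p, G.dist u w = p ∧ G.dist u x = p ∧ G.dist v w = p ∧ G.dist v x = p ∧
      G.dist u v ≤ 2 * p ∧ G.dist w x ≤ 2 * p ∧
      2 * p ≤ G.dist u v + 1 ∧ 2 * p ≤ G.dist w x + 1 := by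
  have := G.dist_comm (u := u) (v := v)
  have := G.dist_comm (u := u) (v := w)
  have := G.dist_comm (u := u) (v := x)
  have := G.dist_comm (u := v) (v := w)
  have := G.dist_comm (u := v) (v := x)
  have := G.dist_comm (u := w) (v := x)
  have hu := h.dist_add_dist_le hHelly hconn
  have hv := h.swap.dist_add_dist_le hHelly hconn
  have hw := h.transpose.dist_add_dist_le hHelly hconn
  have hx := h.transpose.swap.dist_add_dist_le hHelly hconn
  have h1 := h.side_sum_le hHelly hconn
  have h2 := h.swap.side_sum_le hHelly hconn
  have := hconn.dist_triangle (u := w) (v := u) (w := x)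
  have := hconn.dist_triangle (u := w) (v := v) (w := x)
  have := hconn.dist_triangle (u := u) (v := w) (w := v)
  have := hconn.dist_triangle (u := u) (v := x) (w := v)
  exact ⟨G.dist u w, by omega⟩

/-- Otherwise moving both `w` and `v` towards the opposite side `u x` turns the square into a
rectangle that is still separated. -/
theorem IsMinSeparated.diag_sum_le (h : IsMinSeparated G N u v w x) (hHelly : IsHelly G)
    (hconn : G.Connected) (hN : 1 ≤ N) :
    G.dist u v + G.dist w x ≤ G.dist u w + G.dist v x + N + 1 := by
  by_contra hlt
  have := G.dist_comm (u := u) (v := v)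
  have := G.dist_comm (u := u) (v := w)
  have := G.dist_comm (u := u) (v := x)
  have := G.dist_comm (u := v) (v := w)
  have := G.dist_comm (u := v) (v := x)
  have := G.dist_comm (u := w) (v := x)
  obtain ⟨p, h1, h2, h3, h4, h5, h6, h7, h8⟩ := h.exists_side hHelly hconn
  obtain ⟨w', a1, a2, a3⟩ := hHelly.exists_step hconn (u := w) (w := u) (x := x)
    (r := p - 1) (s := G.dist w x - 1) (by omega) (by omega) (by omega)
  have a4 := a3 x
  have a5 := a3 v
  have := G.dist_comm (u := v) (v := w')
  have := G.dist_comm (u := x) (v := w')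
  obtain ⟨v', b1, b2, b3⟩ := hHelly.exists_step hconn (u := v) (w := x) (x := w')
    (r := p - 1) (s := p) (by omega) (by omega) (by omega)
  have b4 := b3 u
  have := G.dist_comm (u := u) (v := v')
  have := G.dist_comm (u := u) (v := w')
  have h9 := h.weight_le u v' w' x ⟨by omega, by omega⟩
  unfold weight at h9
  omega

/-- Otherwise moving `w`, `v` and `x` in turn shortens all four sides by one, while the diagonals
become at least `2p - 2` and `2p - 3`, where `p` is the length of the sides. -/
theorem IsMinSeparated.diag_sum_le_of_odd (h : IsMinSeparated G N u v w x) (hHelly : IsHelly G)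
    (hconn : G.Connected) (hN : 1 ≤ N) (huv : Odd (G.dist u v)) (hwx : Odd (G.dist w x)) :
    G.dist u v + G.dist w x ≤ G.dist u w + G.dist v x + N := by
  by_contra hlt
  obtain ⟨m, hm⟩ := huv
  obtain ⟨n, hn⟩ := hwx
  have := G.dist_comm (u := u) (v := v)
  have := G.dist_comm (u := u) (v := w)
  have := G.dist_comm (u := u) (v := x)
  have := G.dist_comm (u := v) (v := w)
  have := G.dist_comm (u := v) (v := x)
  have := G.dist_comm (u := w) (v := x)
  obtain ⟨p, h1, h2, h3, h4, h5, h6, h7, h8⟩ := h.exists_side hHelly hconn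
  obtain ⟨w', a0, a1, a2, a3⟩ := hHelly.exists_dist_le₄ hconn (a := w) (b := u) (c := v) (d := x)
    (p := 1) (q := p - 1) (r := p) (s := 2 * p - 2) (by omega) (by omega) (by omega) (by omega)
    (by omega) (by omega)
  have := hconn.dist_triangle (u := w) (v := w') (w := x)
  have := G.dist_comm (u := w') (v := x)
  have := G.dist_comm (u := w') (v := v)
  obtain ⟨v', b1, b2, b3⟩ := hHelly.exists_step hconn (u := v) (w := x) (x := w')
    (r := p - 1) (s := p - 1) (by omega) (by omega) (by omega)
  have b4 := b3 u
  have := G.dist_comm (u := v') (v := u)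
  have := G.dist_comm (u := v') (v := x)
  have := hconn.dist_triangle (u := u) (v := w') (w := v')
  have := G.dist_comm (u := w') (v := v')
  obtain ⟨x', c1, c2, c3⟩ := hHelly.exists_step hconn (u := x) (w := u) (x := v')
    (r := p - 1) (s := p - 1) (by omega) (by omega) (by omega)
  have c4 := c3 w'
  have := G.dist_comm (u := x') (v := u)
  have := G.dist_comm (u := x') (v := v')
  have := G.dist_comm (u := x') (v := w')
  have h9 := h.weight_le u v' w' x' ⟨by omega, by omega⟩
  unfold weight at h9
  omega

end IsMinSeparated

/-! ### Hyperbolicity and squares -/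

theorem hb_le_half_iff [Finite V] [Nonempty V] (G : SimpleGraph V) (m : ℕ) :
    hb G ≤ m / 2 ↔ ∀ u v w x, ¬ Separated G (m + 1) u v w x := by
  constructor
  · intro h
    have key : ∀ u v w x, Separated G (m + 1) u v w x →
        ¬ G.dist u x + G.dist v w ≤ G.dist u w + G.dist v x := by
      rintro u v w x ⟨h1, h2⟩ h3
      have h4 := (isLeast_hb G).1 u v w x (by omega) h3
      have h5 : (G.dist u w : ℝ) + G.dist v x + (m + 1) ≤ G.dist u v + G.dist w x := by
        exact_mod_cast h1
      linarith
    intro u v w x hs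
    have h1 := key u v w x hs
    have h2 := key v u w x hs.swap
    omega
  · intro h
    refine (isLeast_hb G).2 fun u v w x h1 h2 => ?_
    by_contra! hlt
    have h3 : G.dist u w + G.dist v x + m < G.dist u v + G.dist w x := by
      have : (G.dist u w : ℝ) + G.dist v x + m < G.dist u v + G.dist w x := by linarith
      exact_mod_cast this
    exact h u v w x ⟨by omega, by omega⟩

/-- Here the square of least weight has sides `k + 1` and diagonals in `{2k + 1, 2k + 2}`, not both
`2k + 1`. -/
theorem Separated.exists_odd_square {G : SimpleGraph V} {k : ℕ} {u v w x : V}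
    (h : Separated G (2 * k + 1) u v w x) (hHelly : IsHelly G) (hconn : G.Connected) :
    ∃ u v w x, G.dist u w ≤ k + 1 ∧ G.dist u x ≤ k + 1 ∧ G.dist v w ≤ k + 1 ∧
      G.dist v x ≤ k + 1 ∧ G.dist u v = 2 * k + 1 ∧ 2 * k + 2 ≤ G.dist w x := by
  obtain ⟨u, v, w, x, hmin⟩ := h.exists_isMinSeparated
  have := G.dist_comm (u := u) (v := v)
  have := G.dist_comm (u := u) (v := w)
  have := G.dist_comm (u := u) (v := x)
  have := G.dist_comm (u := v) (v := w)
  have := G.dist_comm (u := v) (v := x)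
  obtain ⟨h1, h2⟩ := hmin.separated
  have hle := hmin.diag_sum_le hHelly hconn (by omega)
  have hodd := hmin.diag_sum_le_of_odd hHelly hconn (by omega)
  obtain ⟨p, h3, h4, h5, h6, h7, h8, h9, h10⟩ := hmin.exists_side hHelly hconn
  have hp : p = k + 1 := by
    by_contra hne
    have := hodd ⟨p - 1, by omega⟩ ⟨p - 1, by omega⟩
    omega
  by_cases huv : G.dist u v = 2 * k + 1
  · exact ⟨u, v, w, x, by omega⟩
  by_cases hwx : G.dist w x = 2 * k + 1
  · exact ⟨w, x, u, v, by omega⟩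
  -- Both diagonals have length `2k + 2`; moving `v` towards `u` shortens one of them.
  obtain ⟨v', a0, a1, a2, a3⟩ := hHelly.exists_dist_le₄ hconn (a := v) (b := u) (c := w) (d := x)
    (p := 1) (q := 2 * k + 1) (r := k + 1) (s := k + 1) (by omega) (by omega) (by omega)
    (by omega) (by omega) (by omega)
  have := hconn.dist_triangle (u := v) (v := v') (w := u)
  have := G.dist_comm (u := v') (v := u)
  have := G.dist_comm (u := v') (v := w)
  have := G.dist_comm (u := v') (v := x)
  exact ⟨u, v', w, x, by omega⟩

/-- The two outcomes correspond to the two families of forbidden four-cycles. The second contains the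
square with sides `k + 2` and both diagonals `2k + 3`, whose separation is also `2k + 2` because the
diagonals fall short of twice the side. -/
theorem Separated.exists_even_square {G : SimpleGraph V} {k : ℕ} {u v w x : V}
    (h : Separated G (2 * k + 2) u v w x) (hHelly : IsHelly G) (hconn : G.Connected) :
    ∃ u v w x, ∃ p, G.dist u w ≤ p ∧ G.dist u x ≤ p ∧ G.dist v w ≤ p ∧ G.dist v x ≤ p ∧
      (p = k + 1 ∧ 2 * k + 2 ≤ G.dist u v ∧ 2 * k + 2 ≤ G.dist w x ∨
        p = k + 2 ∧ 2 * k + 3 ≤ G.dist u v ∧ 2 * k + 3 ≤ G.dist w x) := by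
  obtain ⟨u, v, w, x, hmin⟩ := h.exists_isMinSeparated
  obtain ⟨h1, h2⟩ := hmin.separated
  have hle := hmin.diag_sum_le hHelly hconn (by omega)
  obtain ⟨p, h3, h4, h5, h6, h7, h8, h9, h10⟩ := hmin.exists_side hHelly hconn
  exact ⟨u, v, w, x, p, by omega⟩

/-! ### Four-cycles and diamonds in powers -/

theorem nonempty_induce_range_iso {ι : Type*} {H : SimpleGraph V} {K : SimpleGraph ι} {f : ι → V}
    (hf : f.Injective) (h : ∀ i j, H.Adj (f i) (f j) ↔ K.Adj i j) :
    Nonempty (H.induce (Set.range f) ≃g K) :=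
  ⟨SimpleGraph.Iso.symm ⟨Equiv.ofInjective f hf, fun {i j} => h i j⟩⟩

/-- The vertices of a quadruple in the cyclic order `u, w, v, x` in which the pairs `u, v` and
`w, x` are opposite. -/
def corners (u v w x : V) : Fin 4 → V := ![u, w, v, x]

theorem corners_injective {G : SimpleGraph V} {a : ℕ} {u v w x : V} (huw : G.dist u w ≤ a)
    (hux : G.dist u x ≤ a) (hvw : G.dist v w ≤ a) (hvx : G.dist v x ≤ a) (huv : u ≠ v)
    (hwx : a < G.dist w x) : (corners u v w x).Injective := by
  have h1 : w ≠ x := by rintro rfl; simp at hwx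
  have h2 : u ≠ w := by rintro rfl; omega
  have h3 : u ≠ x := by rintro rfl; rw [SimpleGraph.dist_comm] at hwx; omega
  have h4 : v ≠ w := by rintro rfl; omega
  have h5 : v ≠ x := by rintro rfl; rw [SimpleGraph.dist_comm] at hwx; omega
  intro i j
  fin_cases i <;> fin_cases j <;> simp [corners, *, huv.symm, h1.symm, h2.symm, h3.symm, h4.symm,
    h5.symm]

theorem cycleGraph_four_adj_iff (i j : Fin 4) :
    (SimpleGraph.cycleGraph 4).Adj i j ↔ i ≠ j ∧ i ≠ j + 2 := by
  revert i j
  decide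

theorem diamond_adj_iff (i j : Fin 4) :
    diamond.Adj i j ↔ i ≠ j ∧ ¬ (i = 1 ∧ j = 3) ∧ ¬ (i = 3 ∧ j = 1) := by
  simp only [diamond, SimpleGraph.sup_adj, SimpleGraph.edge_adj, SimpleGraph.cycleGraph_adj]
  revert i j
  decide

theorem formsC4_power_corners {G : SimpleGraph V} {ℓ : ℕ} {u v w x : V}
    (hf : (corners u v w x).Injective) (huw : G.dist u w ≤ ℓ) (hux : G.dist u x ≤ ℓ)
    (hvw : G.dist v w ≤ ℓ) (hvx : G.dist v x ≤ ℓ) (huv : ℓ < G.dist u v) (hwx : ℓ < G.dist w x) :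
    FormsC4 (power G ℓ) (Set.range (corners u v w x)) := by
  refine nonempty_induce_range_iso hf fun i j => ?_
  simp only [power, hf.ne_iff, cycleGraph_four_adj_iff]
  have := G.dist_comm (u := u) (v := v)
  have := G.dist_comm (u := u) (v := w)
  have := G.dist_comm (u := u) (v := x)
  have := G.dist_comm (u := v) (v := w)
  have := G.dist_comm (u := v) (v := x)
  have := G.dist_comm (u := w) (v := x)
  fin_cases i <;> fin_cases j <;> simp [corners] <;> omega

theorem formsDiamond_power_corners {G : SimpleGraph V} {ℓ : ℕ} {u v w x : V}
    (hf : (corners u v w x).Injective) (huw : G.dist u w ≤ ℓ) (hux : G.dist u x ≤ ℓ)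
    (hvw : G.dist v w ≤ ℓ) (hvx : G.dist v x ≤ ℓ) (huv : G.dist u v ≤ ℓ) (hwx : ℓ < G.dist w x) :
    FormsDiamond (power G ℓ) (Set.range (corners u v w x)) := by
  refine nonempty_induce_range_iso hf fun i j => ?_
  simp only [power, hf.ne_iff, diamond_adj_iff]
  have := G.dist_comm (u := u) (v := v)
  have := G.dist_comm (u := u) (v := w)
  have := G.dist_comm (u := u) (v := x)
  have := G.dist_comm (u := v) (v := w)
  have := G.dist_comm (u := v) (v := x)
  have := G.dist_comm (u := w) (v := x)
  fin_cases i <;> fin_cases j <;> simp [corners] <;> omega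

theorem ncard_range_corners {u v w x : V} (hf : (corners u v w x).Injective) :
    (Set.range (corners u v w x)).ncard = 4 := by
  simp [Set.ncard_range_of_injective hf]

/-- The four-cycle has no proper spanning subgraph isomorphic to it. -/
theorem cycleGraph_four_adj_of_hom (σ : Equiv.Perm (Fin 4))
    (h : ∀ i j, (SimpleGraph.cycleGraph 4).Adj i j → (SimpleGraph.cycleGraph 4).Adj (σ i) (σ j))
    (i j : Fin 4) (hij : (SimpleGraph.cycleGraph 4).Adj (σ i) (σ j)) :
    (SimpleGraph.cycleGraph 4).Adj i j := by
  revert σ i j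
  decide

/-- A set that is a four-cycle in two powers `a ≤ b` has the same sides and diagonals in both, so
that the sides have length at most `a` and the diagonals length more than `b`. Any pair of vertices
at distance more than `b` is then a diagonal. -/
theorem FormsC4.exists_corners {G : SimpleGraph V} {a b : ℕ} {S : Set V} (hab : a ≤ b)
    (ha : FormsC4 (power G a) S) (hb : FormsC4 (power G b) S) :
    ∃ u v w x, G.dist u w ≤ a ∧ G.dist u x ≤ a ∧ G.dist v w ≤ a ∧ G.dist v x ≤ a ∧
      b < G.dist u v ∧ b < G.dist w x ∧ S = {u, v, w, x} := by
  obtain ⟨φ⟩ := ha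
  obtain ⟨ψ⟩ := hb
  have hφ : ∀ i j, (SimpleGraph.cycleGraph 4).Adj i j ↔
      (power G a).Adj (φ.symm i) (φ.symm j) := fun i j => φ.symm.map_adj_iff.symm
  have hψ : ∀ i j, (power G b).Adj (φ.symm i) (φ.symm j) ↔
      (SimpleGraph.cycleGraph 4).Adj (ψ (φ.symm i)) (ψ (φ.symm j)) :=
    fun i j => ψ.map_adj_iff.symm
  have hback : ∀ i j, (power G b).Adj (φ.symm i) (φ.symm j) →
      (SimpleGraph.cycleGraph 4).Adj i j := by
    intro i j hij
    refine cycleGraph_four_adj_of_hom (φ.symm.toEquiv.trans ψ.toEquiv) (fun i j h => ?_) i j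
      ((hψ i j).1 hij)
    have h1 := (hφ i j).1 h
    exact (hψ i j).1 ⟨h1.1, h1.2.trans hab⟩
  have hfar : ∀ i j, i ≠ j → ¬ (SimpleGraph.cycleGraph 4).Adj i j →
      b < G.dist (φ.symm i : V) (φ.symm j) := by
    intro i j hne hij
    by_contra! hle
    exact hij (hback i j ⟨fun h => hne (φ.symm.injective (Subtype.ext h)), hle⟩)
  refine ⟨φ.symm 0, φ.symm 2, φ.symm 1, φ.symm 3, ((hφ 0 1).1 (by decide)).2,
    ((hφ 0 3).1 (by decide)).2, ((hφ 2 1).1 (by decide)).2, ((hφ 2 3).1 (by decide)).2,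
    hfar 0 2 (by decide) (by decide), hfar 1 3 (by decide) (by decide), ?_⟩
  ext y
  constructor
  · intro hy
    obtain ⟨i, hi⟩ := φ.symm.surjective ⟨y, hy⟩
    have hi' : y = (φ.symm i : V) := by rw [hi]
    fin_cases i <;> simp_all
  · rintro (rfl | rfl | rfl | rfl) <;> exact Subtype.coe_prop _

theorem FormsDiamond.exists_corners {H : SimpleGraph V} {S : Set V} (h : FormsDiamond H S) :
    ∃ u ∈ S, ∃ v ∈ S, ∃ w ∈ S, ∃ x ∈ S, H.Adj u w ∧ H.Adj u x ∧ H.Adj v w ∧ H.Adj v x ∧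
      H.Adj u v ∧ w ≠ x ∧ ¬ H.Adj w x := by
  obtain ⟨φ⟩ := h
  have hφ : ∀ i j, H.Adj (φ.symm i) (φ.symm j) ↔ diamond.Adj i j :=
    fun i j => φ.symm.map_adj_iff
  refine ⟨_, (φ.symm 0).2, _, (φ.symm 2).2, _, (φ.symm 1).2, _, (φ.symm 3).2, ?_, ?_, ?_, ?_, ?_,
    ?_, ?_⟩
  pick_goal 6
  · exact fun h => absurd (φ.symm.injective (Subtype.ext h)) (by decide)
  all_goals
    rw [hφ, diamond_adj_iff]
    decide

/-- Four vertices with sides at most `k + 1` and diagonals at least `2k + 1` and `2k + 2` are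
separated. -/
theorem exists_separated_of_formsC4_of_formsDiamond {G : SimpleGraph V} (hconn : G.Connected)
    {k : ℕ} {S : Set V}
    (hC : ∀ ℓ ∈ Set.Icc (k + 1) (2 * k), FormsC4 (power G ℓ) S)
    (hD : FormsDiamond (power G (2 * k + 1)) S) :
    ∃ u v w x, Separated G (2 * k + 1) u v w x := by
  obtain ⟨u, hu, v, hv, w, hw, x, hx, huw, hux, hvw, hvx, huv, hne, hwx⟩ := hD.exists_corners
  have hwx' : 2 * k + 1 < G.dist w x := by
    by_contra! hle
    exact hwx ⟨hne, hle⟩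
  have := G.dist_comm (u := w) (v := x)
  rcases Nat.eq_zero_or_pos k with rfl | hk
  · -- There is no four-cycle condition, but the sides are edges of `G`.
    have h1 := huw.2
    have h2 := hux.2
    have h3 := hvw.2
    have h4 := hvx.2
    have h5 := hconn.pos_dist_of_ne huv.1
    exact ⟨u, v, w, x, by omega, by omega⟩
  · obtain ⟨a, b, c, d, h1, h2, h3, h4, h5, h6, rfl⟩ := FormsC4.exists_corners (by omega)
      (hC (k + 1) ⟨le_rfl, by omega⟩) (hC (2 * k) ⟨by omega, le_rfl⟩)
    have := G.dist_comm (u := a) (v := b)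
    have := G.dist_comm (u := a) (v := c)
    have := G.dist_comm (u := a) (v := d)
    have := G.dist_comm (u := b) (v := c)
    have := G.dist_comm (u := b) (v := d)
    have := G.dist_comm (u := c) (v := d)
    -- The only pairs at distance more than `2k + 1` are the diagonals of the four-cycle.
    have hdiag : 2 * k + 1 < G.dist a b ∨ 2 * k + 1 < G.dist c d := by
      rcases hw with rfl | rfl | rfl | rfl <;> rcases hx with rfl | rfl | rfl | rfl <;>
        first | omega | exact absurd rfl hne
    exact ⟨a, b, c, d, by omega, by omega⟩

theorem exists_separated_of_formsC4 {G : SimpleGraph V} {a b : ℕ} {S : Set V} (hab : a ≤ b)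
    (hC : ∀ ℓ ∈ Set.Icc a b, FormsC4 (power G ℓ) S) :
    ∃ u v w x, Separated G (2 * (b + 1) - 2 * a) u v w x := by
  obtain ⟨u, v, w, x, h1, h2, h3, h4, h5, h6, -⟩ := FormsC4.exists_corners hab
    (hC a ⟨le_rfl, hab⟩) (hC b ⟨hab, le_rfl⟩)
  exact ⟨u, v, w, x, by omega, by omega⟩

/-- Converse to `FormsC4.exists_corners`, for all powers between `a` and `b`. -/
theorem exists_formsC4_of_dist {G : SimpleGraph V} {a b : ℕ} {u v w x : V}
    (hab : a ≤ b) (huw : G.dist u w ≤ a) (hux : G.dist u x ≤ a) (hvw : G.dist v w ≤ a)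
    (hvx : G.dist v x ≤ a) (huv : b < G.dist u v) (hwx : b < G.dist w x) :
    ∃ S : Set V, S.ncard = 4 ∧ ∀ ℓ ∈ Set.Icc a b, FormsC4 (power G ℓ) S := by
  have hf : (corners u v w x).Injective :=
    corners_injective huw hux hvw hvx (by rintro rfl; simp at huv) (by omega)
  exact ⟨_, ncard_range_corners hf, fun ℓ hℓ => formsC4_power_corners hf (huw.trans hℓ.1)
    (hux.trans hℓ.1) (hvw.trans hℓ.1) (hvx.trans hℓ.1) (hℓ.2.trans_lt huv) (hℓ.2.trans_lt hwx)⟩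

end HellyHyp

open HellyHyp in
theorem mainTheorem4 {V : Type*} [Finite V] (G : SimpleGraph V) (hconn : G.Connected)
    (hHelly : HellyHyp.IsHelly G) (k : ℕ) :
    (HellyHyp.hb G ≤ (k : ℝ) ↔
      ¬ ∃ S : Set V, S.ncard = 4 ∧
        (∀ ℓ ∈ Set.Icc (k + 1) (2 * k), HellyHyp.FormsC4 (HellyHyp.power G ℓ) S) ∧
        HellyHyp.FormsDiamond (HellyHyp.power G (2 * k + 1)) S) ∧
    (HellyHyp.hb G ≤ (k : ℝ) + 1 / 2 ↔
      (¬ ∃ S : Set V, S.ncard = 4 ∧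
        ∀ ℓ ∈ Set.Icc (k + 1) (2 * k + 1), HellyHyp.FormsC4 (HellyHyp.power G ℓ) S) ∧
      (¬ ∃ S : Set V, S.ncard = 4 ∧
        ∀ ℓ ∈ Set.Icc (k + 2) (2 * k + 2), HellyHyp.FormsC4 (HellyHyp.power G ℓ) S)) := by
  have := hconn.nonempty
  have e1 := hb_le_half_iff G (2 * k)
  have e2 := hb_le_half_iff G (2 * k + 1)
  rw [show ((2 * k : ℕ) : ℝ) / 2 = k by push_cast; ring] at e1
  rw [show ((2 * k + 1 : ℕ) : ℝ) / 2 = k + 1 / 2 by push_cast; ring] at e2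
  rw [e1, e2]
  refine ⟨⟨?_, ?_⟩, ⟨fun h => ⟨?_, ?_⟩, ?_⟩⟩
  · rintro h ⟨S, -, hC, hD⟩
    obtain ⟨u, v, w, x, hs⟩ := exists_separated_of_formsC4_of_formsDiamond hconn hC hD
    exact h u v w x hs
  · intro h u v w x hs
    obtain ⟨u, v, w, x, huw, hux, hvw, hvx, huv, hwx⟩ := hs.exists_odd_square hHelly hconn
    have hf : (corners u v w x).Injective :=
      corners_injective huw hux hvw hvx (by rintro rfl; simp at huv) (by omega)
    exact h ⟨_, ncard_range_corners hf, fun ℓ ⟨h1, h2⟩ => formsC4_power_corners hf (by omega)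
      (by omega) (by omega) (by omega) (by omega) (by omega), formsDiamond_power_corners hf
      (by omega) (by omega) (by omega) (by omega) (by omega) (by omega)⟩
  · rintro ⟨S, -, hC⟩
    obtain ⟨u, v, w, x, hs⟩ := exists_separated_of_formsC4 (by omega) hC
    rw [show 2 * (2 * k + 1 + 1) - 2 * (k + 1) = 2 * k + 1 + 1 by omega] at hs
    exact h u v w x hs
  · rintro ⟨S, -, hC⟩
    obtain ⟨u, v, w, x, hs⟩ := exists_separated_of_formsC4 (by omega) hC
    rw [show 2 * (2 * k + 2 + 1) - 2 * (k + 2) = 2 * k + 1 + 1 by omega] at hs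
    exact h u v w x hs
  · rintro ⟨h1, h2⟩ u v w x hs
    obtain ⟨u, v, w, x, p, huw, hux, hvw, hvx, ⟨rfl, huv, hwx⟩ | ⟨rfl, huv, hwx⟩⟩ :=
      hs.exists_even_square hHelly hconn
    · exact h1 (exists_formsC4_of_dist (by omega) huw hux hvw hvx (by omega) (by omega))
    · exact h2 (exists_formsC4_of_dist (by omega) huw hux hvw hvx (by omega) (by omega))
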